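/- Let $p$ be a prime and let $G$ be a finite $p$-solvable group, that is, a finite group with a normal series each of whose factors is a $p$-group or has order coprime to $p$. Let $P$ be a Sylow $p$-subgroup of $G$ with $N_G(P)=P$, and let $N \trianglelefteq G$. Let $\chi \in \mathrm{Irr}(G)$ be an irreducible complex character whose degree $\chi(1)$ is not divisible by $p$, and let $\theta \in \mathrm{Irr}(N)$ lie under $\chi$, that is, let $\theta$ be an irreducible constituent of the restriction $\chi_N$. Then $\theta$ extends to its stabilizer $G_\theta = \{g \in G : \theta(gng^{-1})=\theta(n) \text{ for all } n \in N\}$; that is, there is $\eta \in \mathrm{Irr}(G_\theta)$ with $\eta_N=\theta$. -/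

import Mathlib

namespace CharExt

/-- A finite group `G` is `p`-solvable if it has a normal series
`1 = N 0 ≤ N 1 ≤ ⋯ ≤ N r = G` (all terms normal in `G`) in which the order of every factor
`N (i + 1) / N i` is a power of `p` or coprime to `p`. -/
def IsPSolvable (p : ℕ) (G : Type*) [Group G] : Prop :=
  ∃ (r : ℕ) (N : ℕ → Subgroup G),
    N 0 = ⊥ ∧ N r = ⊤ ∧ (∀ i ≤ r, (N i).Normal) ∧
    ∀ i < r, N i ≤ N (i + 1) ∧
      ((∃ k : ℕ, (N i).relIndex (N (i + 1)) = p ^ k) ∨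
        ((N i).relIndex (N (i + 1))).Coprime p)

/-- `χ ∈ Irr(G)`: the function `χ` is the character of an irreducible finite-dimensional
complex representation of `G`. -/
def IsIrrChar {G : Type*} [Group G] (χ : G → ℂ) : Prop :=
  ∃ (n : ℕ) (ρ : Representation ℂ G (Fin n → ℂ)), ρ.IsIrreducible ∧ ρ.character = χ

/-- The degree `χ 1` is a natural number coprime to `p`. -/
def HasPrimeToDegree (p : ℕ) {G : Type*} [Group G] (χ : G → ℂ) : Prop :=
  ∃ d : ℕ, χ 1 = (d : ℂ) ∧ d.Coprime p

/-- `ψ` is an (irreducible) constituent of `Δ`: one has `Δ = ∑ a_φ φ` over `φ ∈ Irr(H)`, with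
natural numbers `a_φ` and `a_ψ ≠ 0`. -/
def IsConstituent {H : Type*} [Group H] (ψ Δ : H → ℂ) : Prop :=
  ∃ a : (H → ℂ) →₀ ℕ,
    (∀ φ ∈ a.support, IsIrrChar φ) ∧ Δ = a.sum (fun φ m => m • φ) ∧ a ψ ≠ 0

/-- `θ` lies under `χ`: it is a constituent of the restriction of `χ` to `N`. -/
def LiesUnder {G : Type*} [Group G] {N : Subgroup G} (θ : N → ℂ) (χ : G → ℂ) : Prop :=
  IsConstituent θ (fun n : N => χ n)

/-- The stabilizer `G_θ` of a function `θ` on a normal subgroup `N` under the action of `G` by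
conjugation: the `g` with `θ (g n g⁻¹) = θ n` for all `n ∈ N`. -/
def stabilizer {G : Type*} [Group G] {N : Subgroup G} [N.Normal] (θ : N → ℂ) : Subgroup G where
  carrier := {g | ∀ n : N, θ (MulAut.conjNormal g n) = θ n}
  one_mem' := by intro n; simp
  mul_mem' := by
    intro a b ha hb n
    rw [map_mul, MulAut.mul_apply, ha, hb]
  inv_mem' := by
    intro a ha n
    rw [← ha, ← MulAut.mul_apply, ← map_mul]
    simp

/-- `θ` extends to the subgroup `H`: `H` contains `N`, and some irreducible character of `H`
restricts to `θ` on `N`. -/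
def ExtendsTo {G : Type*} [Group G] {N : Subgroup G} (θ : N → ℂ) (H : Subgroup G) : Prop :=
  ∃ (hNH : N ≤ H) (η : H → ℂ), IsIrrChar η ∧ ∀ n : N, η (Subgroup.inclusion hNH n) = θ n

end CharExt

namespace CharExt

open Module

/-! ### Irreducibility through invariant subspaces -/

section Irreducible

variable {G V : Type*} [Group G] [AddCommGroup V] [Module ℂ V] {ρ : Representation ℂ G V}

/-! Let `ρ` on `V` afford `χ` and `σ` on `U` afford `θ`. The proof is an induction on the order of
`G` and, for fixed `G`, on how far `N` is from lying in `ker ρ`. If `N ≤ ker ρ`, then `σ` is trivial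
and extends. Otherwise take the first term of the normal series whose intersection with `N` is not
in `ker ρ`; the exponent of its image under `ρ` divides a power of `p` or a number prime to `p`.

The second case cannot occur (`le_ker_of_coprime`): as `P` is self-normalizing, conjugation by `P`
on that image fixes only the identity. Summing traces gives `dim V` modulo `p`, so the sum of the
operators is nonzero, fixed vectors exist, and the image is trivial.

In the first case the image is a nontrivial `p`-group. The preimage `K` of its centre is normal in
`G` and acts by commuting diagonalizable operators. Let `T` be the stabilizer in `G` of a weight `μ`
of `K` on `U`. Then `dim V = |G : T| * dim V_μ`, so both factors are prime to `p` and the Sylow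
`p`-subgroups of `T` are again self-normalizing. If `T < G`, induction extends the action of `N ∩ T`
on `U_μ` to `H ∩ T`, where `H` is the stabilizer of `θ`, and Clifford theory lifts this to an
extension of `σ` to `H` (`exists_extension_of_subspace`). If `T = G`, then `K` acts on `V` by the
scalars `μ`, and since `dim V` is prime to `p` a power of `det ρ` agrees with `μ` on `K`; dividing
by it puts `K` into the kernel, and the inner induction applies. -/

theorem isIrreducible_iff : ρ.IsIrreducible ↔ Nontrivial V ∧
    ∀ W : Submodule ℂ V, (∀ g, ∀ w ∈ W, ρ g w ∈ W) → W = ⊥ ∨ W = ⊤ := by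
  constructor
  · intro h
    refine ⟨?_, fun W hW => ?_⟩
    · by_contra hn
      rw [not_nontrivial_iff_subsingleton] at hn
      refine (bot_ne_top : (⊥ : Subrepresentation ρ) ≠ ⊤) ?_
      exact Subrepresentation.toSubmodule_injective (Subsingleton.elim _ _)
    · rcases eq_bot_or_eq_top (⟨W, fun g v hv => hW g v hv⟩ : Subrepresentation ρ) with h | h
      · exact Or.inl (congrArg Subrepresentation.toSubmodule h)
      · exact Or.inr (congrArg Subrepresentation.toSubmodule h)
  · rintro ⟨hn, h⟩
    have : Nontrivial (Subrepresentation ρ) :=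
      ⟨⊥, ⊤, fun e => (bot_ne_top : (⊥ : Submodule ℂ V) ≠ ⊤)
        (congrArg Subrepresentation.toSubmodule e)⟩
    refine ⟨fun W => ?_⟩
    rcases h W.toSubmodule (fun g w hw => W.apply_mem_toSubmodule g hw) with h | h
    · exact Or.inl (Subrepresentation.toSubmodule_injective h)
    · exact Or.inr (Subrepresentation.toSubmodule_injective h)

theorem iSup_map_eq_top (hρ : ρ.IsIrreducible) {W : Submodule ℂ V} (hW : W ≠ ⊥) :
    ⨆ g, W.map (ρ g) = ⊤ := by
  refine ((isIrreducible_iff.1 hρ).2 _ fun g w hw => ?_).resolve_left fun h => hW ?_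
  · have : (⨆ x, W.map (ρ x)).map (ρ g) ≤ ⨆ x, W.map (ρ x) := by
      rw [Submodule.map_iSup]
      refine iSup_le fun x => ?_
      rw [← Submodule.map_comp]
      refine le_trans (le_of_eq ?_) (le_iSup _ (g * x))
      rw [map_mul]; rfl
    exact this (Submodule.mem_map_of_mem hw)
  · rw [eq_bot_iff, ← h]
    refine le_trans (le_of_eq ?_) (le_iSup _ 1)
    rw [map_one]; exact (Submodule.map_id W).symm

end Irreducible

/-! ### Systems of imprimitivity -/

section Imprimitivity

variable {G V I : Type*} [Group G] [AddCommGroup V] [Module ℂ V] {ρ : Representation ℂ G V}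
  {E : I → Submodule ℂ V} {act : G →* Equiv.Perm I}

theorem exists_act_eq (hρ : ρ.IsIrreducible) (hE : iSupIndep E)
    (hact : ∀ g i, (E i).map (ρ g) ≤ E (act g i)) {i j : I} (hi : E i ≠ ⊥) (hj : E j ≠ ⊥) :
    ∃ g, act g i = j := by
  by_contra! h
  refine hj ?_
  have htop : ⨆ k, ⨆ _ : k ≠ j, E k = ⊤ := by
    rw [eq_top_iff, ← iSup_map_eq_top hρ hi]
    exact iSup_le fun g => (hact g i).trans (le_iSup₂_of_le _ (h g) le_rfl)
  simpa [htop] using hE j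

/-- The translates of `W` span `V`, and each lies in `W` or in another block. So `W` together with
the other blocks is everything, and the modular law gives `W = E i`. This makes each nonzero block
irreducible under its stabilizer. -/
theorem eq_of_le_of_stable (hρ : ρ.IsIrreducible) (hE : iSupIndep E)
    (hact : ∀ g i, (E i).map (ρ g) ≤ E (act g i)) {i : I} {W : Submodule ℂ V} (hW : W ≤ E i)
    (hW0 : W ≠ ⊥) (hstab : ∀ g, act g i = i → ∀ w ∈ W, ρ g w ∈ W) : W = E i := by
  have htop : W ⊔ (⨆ k, ⨆ _ : k ≠ i, E k) = ⊤ := by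
    rw [eq_top_iff, ← iSup_map_eq_top hρ hW0]
    refine iSup_le fun g => ?_
    by_cases hg : act g i = i
    · exact le_sup_of_le_left (Submodule.map_le_iff_le_comap.2 fun w hw => hstab g hg w hw)
    · exact le_sup_of_le_right (((Submodule.map_mono hW).trans (hact g i)).trans
        (le_iSup₂_of_le _ hg le_rfl))
  have h := sup_inf_assoc_of_le (⨆ k, ⨆ _ : k ≠ i, E k) hW
  rw [htop, top_inf_eq, inf_comm, (hE i).eq_bot, sup_bot_eq] at h
  exact h.symm

/-- The stabilizer of an index of a system of imprimitivity. -/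
def actStabilizer (act : G →* Equiv.Perm I) (i : I) : Subgroup G :=
  (MulAction.stabilizer (Equiv.Perm I) i).comap act

theorem mem_actStabilizer {i : I} {g : G} : g ∈ actStabilizer act i ↔ act g i = i := Iff.rfl

theorem finrank_eq_index_mul [Finite G] [FiniteDimensional ℂ V] (hρ : ρ.IsIrreducible)
    (hE : iSupIndep E) (hact : ∀ g i, (E i).map (ρ g) ≤ E (act g i)) {i : I} (hi : E i ≠ ⊥) :
    finrank ℂ V = (actStabilizer act i).index * finrank ℂ (E i) := by
  classical
  set T := actStabilizer act i
  have hq : ∀ g h : G, (QuotientGroup.mk g : G ⧸ T) = QuotientGroup.mk h ↔ act g i = act h i := by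
    intro g h
    rw [QuotientGroup.eq, mem_actStabilizer, map_mul, map_inv, Equiv.Perm.mul_apply,
      Equiv.Perm.inv_eq_iff_eq]
    exact eq_comm
  let e : G ⧸ T → I := fun x => act x.out i
  have he : ∀ g : G, e g = act g i := fun g => (hq _ _).1 (QuotientGroup.out_eq' _)
  have hinj : Function.Injective e := by
    intro x y hxy
    rw [← QuotientGroup.out_eq' x, ← QuotientGroup.out_eq' y]
    exact (hq _ _).2 hxy
  have hind : iSupIndep (E ∘ e) := hE.comp hinj
  have htop : iSup (E ∘ e) = ⊤ := by
    rw [eq_top_iff, ← iSup_map_eq_top hρ hi]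
    refine iSup_le fun g => (hact g i).trans ?_
    rw [← he]
    exact le_iSup (E ∘ e) (g : G ⧸ T)
  have hint := DirectSum.isInternal_submodule_of_iSupIndep_of_iSup_eq_top hind htop
  have : Fintype (G ⧸ T) := Fintype.ofFinite _
  rw [← (LinearEquiv.ofBijective (DirectSum.coeLinearMap (E ∘ e)) hint).finrank_eq,
    finrank_directSum]
  have hdim : ∀ x : G ⧸ T, finrank ℂ ((E ∘ e) x) = finrank ℂ (E i) := by
    intro x
    have hle : ∀ g j, finrank ℂ (E j) ≤ finrank ℂ (E (act g j)) := by
      intro g j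
      refine le_trans (le_of_eq ?_) (Submodule.finrank_mono (hact g j))
      refine (LinearEquiv.finrank_eq (Submodule.equivMapOfInjective (ρ g) ?_ _))
      exact Function.LeftInverse.injective (g := ρ g⁻¹) fun v => by simp
    refine le_antisymm ?_ (hle _ _)
    have := hle x.out⁻¹ (act x.out i)
    rwa [← Equiv.Perm.mul_apply, ← map_mul, inv_mul_cancel, map_one, Equiv.Perm.one_apply] at this
  simp only [hdim, Finset.sum_const, smul_eq_mul, Finset.card_univ]
  rw [Subgroup.index, Nat.card_eq_fintype_card]

end Imprimitivity

/-! ### Common eigenspaces of commuting operators -/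

section Weights

variable {ι V : Type*} [AddCommGroup V] [Module ℂ V]

/-- The common eigenspace of a family of endomorphisms. -/
def weightSpace (f : ι → End ℂ V) (μ : ι → ℂ) : Submodule ℂ V :=
  ⨅ i, (f i).eigenspace (μ i)

theorem mem_weightSpace {f : ι → End ℂ V} {μ : ι → ℂ} {v : V} :
    v ∈ weightSpace f μ ↔ ∀ i, f i v = μ i • v := by
  simp [weightSpace]

theorem iSupIndep_weightSpace {f : ι → End ℂ V} (hf : ∀ i j, Commute (f i) (f j)) :
    iSupIndep (weightSpace f) := by
  refine (End.independent_iInf_maxGenEigenspace_of_forall_mapsTo f fun i j φ =>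
    End.mapsTo_maxGenEigenspace_of_comm (hf j i) φ).mono fun μ => ?_
  exact iInf_mono fun i => End.eigenspace_le_maxGenEigenspace

theorem exists_weightSpace_ne_bot [FiniteDimensional ℂ V] [Nontrivial V] {f : ι → End ℂ V}
    (hf : ∀ i j, Commute (f i) (f j)) {n : ℕ} (hn : n ≠ 0) (hfn : ∀ i, f i ^ n = 1) :
    ∃ μ, weightSpace f μ ≠ ⊥ := by
  by_contra! h
  have hss : ∀ i, (f i).IsFinitelySemisimple := fun i => by
    refine End.IsSemisimple.isFinitelySemisimple
      (End.isSemisimple_of_squarefree_aeval_eq_zero (p := Polynomial.X ^ n - 1) ?_ ?_)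
    · exact ((Polynomial.separable_X_pow_sub_C (1 : ℂ) (by exact_mod_cast hn)
        one_ne_zero).squarefree)
    · simp [hfn]
  have htop := End.iSup_iInf_maxGenEigenspace_eq_top_of_forall_mapsTo f
    (fun i j φ => End.mapsTo_maxGenEigenspace_of_comm (hf j i) φ)
    (fun i => End.iSup_maxGenEigenspace_eq_top (f i))
  have : ∀ μ : ι → ℂ, ⨅ i, (f i).maxGenEigenspace (μ i) = ⊥ := fun μ => by
    rw [← h μ, weightSpace]
    exact iInf_congr fun i => (hss i).maxGenEigenspace_eq_eigenspace _
  simp [this] at htop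

end Weights

/-! ### Maps intertwining a representation with its conjugates -/

section Twisted

variable {G U : Type*} [Group G] {N : Subgroup G} [N.Normal] [AddCommGroup U] [Module ℂ U]

/-- `Y` intertwines `σ` with its conjugate by `g`. -/
def IsTwisted (σ : Representation ℂ N U) (g : G) (Y : End ℂ U) : Prop :=
  ∀ n : N, Y * σ n = σ (MulAut.conjNormal g n) * Y

variable {σ : Representation ℂ N U}

theorem IsTwisted.mul {g h : G} {Y Z : End ℂ U} (hY : IsTwisted σ g Y) (hZ : IsTwisted σ h Z) :
    IsTwisted σ (g * h) (Y * Z) := fun n => by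
  rw [mul_assoc, hZ, ← mul_assoc, hY, mul_assoc, map_mul, MulAut.mul_apply]

theorem isTwisted_apply (n : N) : IsTwisted σ (n : G) (σ n) := fun m => by
  rw [← map_mul, ← map_mul]
  congr 1
  ext
  simp

theorem IsTwisted.smul {g : G} {Y : End ℂ U} (hY : IsTwisted σ g Y) (c : ℂ) :
    IsTwisted σ g (c • Y) := fun n => by
  rw [smul_mul_assoc, hY, mul_smul_comm]

/-- The kernel is `N`-stable. Consequently a map twisted by a given `g` is determined by its value
at one nonzero vector, which is the uniqueness behind the gluing of extensions. -/
theorem IsTwisted.eq_zero (hσ : σ.IsIrreducible) {g : G} {Y : End ℂ U} (hY : IsTwisted σ g Y)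
    {u : U} (hu : u ≠ 0) (h0 : Y u = 0) : Y = 0 := by
  rcases (isIrreducible_iff.1 hσ).2 (LinearMap.ker Y) (fun n w hw => by
    rw [LinearMap.mem_ker] at hw ⊢
    have := LinearMap.congr_fun (hY n) w
    simpa [hw] using this) with h | h
  · exact absurd ((Submodule.mem_bot ℂ).1 (h ▸ (LinearMap.mem_ker.2 h0))) hu
  · exact LinearMap.ker_eq_top.1 h

theorem IsTwisted.ext (hσ : σ.IsIrreducible) {g : G} {Y Z : End ℂ U} (hY : IsTwisted σ g Y)
    (hZ : IsTwisted σ g Z) {u : U} (hu : u ≠ 0) (h : Y u = Z u) : Y = Z := by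
  refine sub_eq_zero.1 (IsTwisted.eq_zero hσ (g := g) (fun n => ?_) hu (by simp [h]))
  rw [sub_mul, mul_sub, hY, hZ]

theorem IsTwisted.injective (hσ : σ.IsIrreducible) {g : G} {Y : End ℂ U} (hY : IsTwisted σ g Y)
    (h0 : Y ≠ 0) : Function.Injective Y := by
  refine (injective_iff_map_eq_zero Y).2 fun u hu => ?_
  by_contra hne
  exact h0 (hY.eq_zero hσ hne hu)

end Twisted

/-! ### Lifting an extension from a weight space to the whole space -/

section Clifford

variable {G U : Type*} [Group G] {N H T : Subgroup G} [N.Normal] [AddCommGroup U] [Module ℂ U]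
  [FiniteDimensional ℂ U] {σ : Representation ℂ N U} {E : Submodule ℂ U}

/-- A representation of `H ∩ T` on a subspace `E` that agrees with the irreducible `N ∩ T`-action
is, elementwise, the restriction of intertwiners of the whole space. -/
theorem exists_isTwisted_extending (hNH : N ≤ H) (hσ : σ.IsIrreducible) (hE : E ≠ ⊥)
    (hEirr : ∀ W ≤ E, W ≠ ⊥ → (∀ n : N, (n : G) ∈ T → ∀ w ∈ W, σ n w ∈ W) → W = E)
    (hX : ∀ h ∈ H, ∃ Y, Y ≠ 0 ∧ IsTwisted σ h Y)
    (hXE : ∀ h ∈ H, h ∈ T → ∀ Y, IsTwisted σ h Y → ∀ u ∈ E, Y u ∈ E)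
    (τ' : Representation ℂ (H.subgroupOf T) E)
    (hτ' : ∀ (n : N) (hn : (n : G) ∈ T) (u : E), (τ' ⟨⟨n, hn⟩, hNH n.2⟩ u : U) = σ n u)
    (t : G) (htH : t ∈ H) (htT : t ∈ T) :
    ∃ Y, IsTwisted σ t Y ∧ ∀ u : E, Y u = τ' ⟨⟨t, htT⟩, htH⟩ u := by
  obtain ⟨X, hX0, hXt⟩ := hX t htH
  set s : H.subgroupOf T := ⟨⟨t, htT⟩, htH⟩
  have hXinj := hXt.injective hσ hX0
  have : Nontrivial E := Submodule.nontrivial_iff_ne_bot.2 hE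
  -- Both `τ' s` and `X` are twisted by the same `t`, so `S` commutes with `N ∩ T`. By Schur's lemma
  -- `S` is a scalar `c`, and `c⁻¹ • X` restricts to `τ' s`.
  let S : End ℂ E := τ' s⁻¹ * X.restrict (hXE t htH htT X hXt)
  obtain ⟨c, hc⟩ := End.exists_eigenvalue S
  have hXS : ∀ u : E, X u = τ' s (S u) := fun u => by
    simp [S]
  have hcomm : ∀ (n : N) (hn : (n : G) ∈ T) (u : E),
      S (τ' ⟨⟨n, hn⟩, hNH n.2⟩ u) = τ' ⟨⟨n, hn⟩, hNH n.2⟩ (S u) := by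
    intro n hn u
    have hm : ((MulAut.conjNormal t n : N) : G) ∈ T := by
      rw [MulAut.conjNormal_apply]
      exact T.mul_mem (T.mul_mem htT hn) (T.inv_mem htT)
    have h1 : X.restrict (hXE t htH htT X hXt) (τ' ⟨⟨n, hn⟩, hNH n.2⟩ u) =
        τ' ⟨⟨_, hm⟩, hNH (MulAut.conjNormal t n).2⟩ (X.restrict (hXE t htH htT X hXt) u) := by
      apply Subtype.ext
      rw [hτ', LinearMap.coe_restrict_apply, LinearMap.coe_restrict_apply, hτ']
      exact LinearMap.congr_fun (hXt n) u
    simp only [S, Module.End.mul_apply, h1]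
    rw [← Module.End.mul_apply (τ' s⁻¹) (τ' _), ← Module.End.mul_apply (τ' _) (τ' s⁻¹), ← map_mul,
      ← map_mul]
    congr 2
    apply Subtype.ext
    apply Subtype.ext
    simp [s, mul_assoc]
  have hSc : ∀ u : E, S u = c • u := by
    have hW := hEirr ((End.eigenspace S c).map E.subtype) (Submodule.map_subtype_le _ _)
      (fun h => hc (Submodule.map_injective_of_injective E.injective_subtype
        (h.trans (Submodule.map_bot _).symm)))
      (by
        rintro n hn _ ⟨w, hw, rfl⟩
        refine ⟨τ' ⟨⟨n, hn⟩, hNH n.2⟩ w, ?_, hτ' n hn w⟩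
        rw [SetLike.mem_coe, End.mem_eigenspace_iff] at hw ⊢
        rw [hcomm, hw, map_smul])
    intro u
    obtain ⟨w, hw, hwu⟩ := hW.ge u.2
    obtain rfl : w = u := Subtype.ext hwu
    exact End.mem_eigenspace_iff.1 hw
  obtain ⟨e, he⟩ := exists_ne (0 : E)
  have hc0 : c ≠ 0 := by
    rintro rfl
    have := hXS e
    rw [hSc, zero_smul, map_zero] at this
    exact he (Subtype.ext (hXinj (by simpa using this)))
  refine ⟨c⁻¹ • X, hXt.smul _, fun u => ?_⟩
  rw [LinearMap.smul_apply, hXS, hSc, map_smul, Submodule.coe_smul, smul_smul,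
    inv_mul_cancel₀ hc0, one_smul]

/-- Every `h` has a translate `n * h` in `T`, where the operator is prescribed on `E`; undoing `σ n`
prescribes it for `h`. The condition `Good` asks for compatibility with all such `n` at once and has
a unique solution, so multiplicativity reduces to checking that a product is `Good`. -/
theorem exists_extension_of_subspace (hNH : N ≤ H) (hσ : σ.IsIrreducible) (hE : E ≠ ⊥)
    (hEirr : ∀ W ≤ E, W ≠ ⊥ → (∀ n : N, (n : G) ∈ T → ∀ w ∈ W, σ n w ∈ W) → W = E)
    (hX : ∀ h ∈ H, ∃ Y, Y ≠ 0 ∧ IsTwisted σ h Y)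
    (hXE : ∀ h ∈ H, h ∈ T → ∀ Y, IsTwisted σ h Y → ∀ u ∈ E, Y u ∈ E)
    (hHT : ∀ h ∈ H, ∃ n : N, (n : G) * h ∈ T)
    (τ' : Representation ℂ (H.subgroupOf T) E)
    (hτ' : ∀ (n : N) (hn : (n : G) ∈ T) (u : E), (τ' ⟨⟨n, hn⟩, hNH n.2⟩ u : U) = σ n u) :
    ∃ τ : Representation ℂ H U, ∀ n : N, τ (Subgroup.inclusion hNH n) = σ n := by
  have hmem : ∀ (n : N) (h : H), (n : G) * h ∈ H := fun n h => H.mul_mem (hNH n.2) h.2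
  let Good : H → End ℂ U → Prop := fun h Z => IsTwisted σ (h : G) Z ∧
    ∀ (n : N) (hn : (n : G) * h ∈ T) (u : E), σ n (Z u) = τ' ⟨⟨n * h, hn⟩, hmem n h⟩ u
  obtain ⟨e, he⟩ : ∃ e : E, (e : U) ≠ 0 := by
    obtain ⟨e, he, h0⟩ := Submodule.exists_mem_ne_zero_of_ne_bot hE
    exact ⟨⟨e, he⟩, h0⟩
  have hinj : ∀ n : N, Function.Injective (σ n) := fun n =>
    Function.LeftInverse.injective (g := σ n⁻¹) fun v => by simp
  have huniq : ∀ h Z Z', Good h Z → Good h Z' → Z = Z' := by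
    intro h Z Z' hZ hZ'
    obtain ⟨n, hn⟩ := hHT h h.2
    refine hZ.1.ext hσ hZ'.1 he (hinj n ?_)
    rw [hZ.2 n hn, hZ'.2 n hn]
  have hex : ∀ h, ∃ Z, Good h Z := by
    intro h
    obtain ⟨m, hm⟩ := hHT h h.2
    obtain ⟨Y, hY, hYτ⟩ := exists_isTwisted_extending hNH hσ hE hEirr hX hXE τ' hτ' _ (hmem m h) hm
    refine ⟨σ m⁻¹ * Y, ?_, fun n hn u => ?_⟩
    · have := (isTwisted_apply (σ := σ) m⁻¹).mul hY
      simpa using this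
    · have hT : ((n * m⁻¹ : N) : G) ∈ T := by
        have := T.mul_mem hn (T.inv_mem hm)
        simpa [mul_assoc] using this
      rw [Module.End.mul_apply, hYτ, ← Module.End.mul_apply, ← map_mul, ← hτ' _ hT,
        ← Module.End.mul_apply, ← map_mul]
      congr 3
      apply Subtype.ext
      apply Subtype.ext
      simp [mul_assoc]
  choose Z hZ using hex
  have hone : Z 1 = 1 := by
    refine huniq 1 _ _ (hZ 1) ⟨by simpa using isTwisted_apply (σ := σ) 1, fun n hn u => ?_⟩
    have hn' : (n : G) ∈ T := by simpa using hn
    rw [Module.End.one_apply, ← hτ' n hn']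
    congr 3
    apply Subtype.ext
    apply Subtype.ext
    simp
  have hmul : ∀ g h, Z (g * h) = Z g * Z h := by
    intro g h
    refine huniq _ _ _ (hZ _) ⟨(hZ g).1.mul (hZ h).1, fun n hn u => ?_⟩
    obtain ⟨m, hm⟩ := hHT h h.2
    -- `Z g` is prescribed only on `E`, which `Z h` need not preserve. So `Z h u` is written as `σ
    -- m⁻¹` of a vector of `E`, and `Z g` is then moved past `σ m⁻¹` by the twisting relation.
    have h1 : Z h u = σ m⁻¹ (τ' ⟨⟨m * h, hm⟩, hmem m h⟩ u) := by
      rw [← (hZ h).2 m hm, ← Module.End.mul_apply, ← map_mul]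
      simp
    have h2 : ((n * MulAut.conjNormal (g : G) m⁻¹ : N) : G) * g ∈ T := by
      have := T.mul_mem hn (T.inv_mem hm)
      simpa [mul_assoc] using this
    rw [Module.End.mul_apply, h1, ← Module.End.mul_apply (Z g), (hZ g).1, Module.End.mul_apply,
      ← Module.End.mul_apply (σ n), ← map_mul, (hZ g).2 _ h2, ← Module.End.mul_apply, ← map_mul]
    congr 3
    apply Subtype.ext
    apply Subtype.ext
    simp [mul_assoc]
  refine ⟨⟨⟨Z, hone⟩, hmul⟩, fun n => ?_⟩
  refine huniq (Subgroup.inclusion hNH n) _ _ (hZ _) ⟨isTwisted_apply n, fun m hm u => ?_⟩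
  rw [← Module.End.mul_apply, ← map_mul, ← hτ' (m * n) (by simpa using hm)]
  rfl

end Clifford

/-! ### Normal subgroups with image of exponent prime to `p` act trivially -/

section Coprime

/-- Away from `x₀`, each level set of `f` is `P`-stable without fixed points, so its size is
divisible by `p`. -/
theorem exists_sum_eq_add_prime_mul {p : ℕ} [Fact p.Prime] {P X : Type*} [Group P]
    (hP : IsPGroup p P) [MulAction P X] [Fintype X] {f : X → ℂ}
    (hf : ∀ (g : P) (x : X), f (g • x) = f x) (hint : ∀ x, IsIntegral ℤ (f x)) {x₀ : X}
    (hx₀ : MulAction.fixedPoints P X = {x₀}) :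
    ∃ β, IsIntegral ℤ β ∧ ∑ x, f x = f x₀ + p * β := by
  classical
  have hfix : ∀ g : P, g • x₀ = x₀ := by
    have : x₀ ∈ MulAction.fixedPoints P X := by simp [hx₀]
    exact this
  have hdvd : ∀ c : ℂ, p ∣ ((Finset.univ.erase x₀).filter (f · = c)).card := by
    intro c
    by_contra hnd
    let S : SubMulAction P X :=
      { carrier := {x | x ≠ x₀ ∧ f x = c}
        smul_mem' := fun g x hx => ⟨fun h => hx.1 (by
          rw [← inv_smul_smul g x, h, hfix]), (hf g x).trans hx.2⟩ }
    have hcard : Nat.card S = ((Finset.univ.erase x₀).filter (f · = c)).card := by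
      refine Nat.subtype_card _ fun x => ?_
      simp only [Finset.mem_filter, Finset.mem_erase, Finset.mem_univ, and_true]
      rfl
    obtain ⟨y, hy⟩ := hP.nonempty_fixed_point_of_prime_not_dvd_card S (hcard ▸ hnd)
    have hy' : (y : X) ∈ MulAction.fixedPoints P X := fun g => congrArg Subtype.val (hy g)
    rw [hx₀] at hy'
    exact y.2.1 hy'
  choose d hd using hdvd
  refine ⟨∑ c ∈ (Finset.univ.erase x₀).image f, d c * c, ?_, ?_⟩
  · refine IsIntegral.sum _ fun c hc => ?_
    obtain ⟨x, -, rfl⟩ := Finset.mem_image.1 hc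
    exact (isIntegral_algebraMap (R := ℤ) (A := ℂ) (x := (d (f x) : ℤ))).mul (hint x)
  · rw [← Finset.add_sum_erase _ _ (Finset.mem_univ x₀)]
    congr 1
    rw [Finset.sum_comp (fun c => c) f, Finset.mul_sum]
    refine Finset.sum_congr rfl fun c _ => ?_
    rw [hd, nsmul_eq_mul]
    push_cast
    ring

theorem isIntegral_trace_of_pow_eq_one {V : Type*} [AddCommGroup V] [Module ℂ V]
    [FiniteDimensional ℂ V] {A : End ℂ V} {n : ℕ} (hn : n ≠ 0) (hA : A ^ n = 1) :
    IsIntegral ℤ (LinearMap.trace ℂ V A) := by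
  rw [End.trace_eq_sum_roots_charpoly_of_splits (IsAlgClosed.splits _)]
  refine IsIntegral.multiset_sum fun c hc => ?_
  have hc' : A.HasEigenvalue c :=
    (End.hasEigenvalue_iff_isRoot_charpoly _ _).2 (Polynomial.isRoot_of_mem_roots hc)
  obtain ⟨v, hv⟩ := hc'.exists_hasEigenvector
  have h1 := hv.pow_apply n
  rw [hA, End.one_apply] at h1
  have h2 : c ^ n = 1 := by
    have : (c ^ n - 1) • v = 0 := by rw [sub_smul, one_smul, ← h1, sub_self]
    exact sub_eq_zero.1 ((smul_eq_zero.1 this).resolve_right hv.2)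
  exact IsIntegral.of_pow (Nat.pos_of_ne_zero hn) (h2 ▸ isIntegral_one)

/-- `P` and its conjugate by `k` are both Sylow in `J`, hence conjugate by some `j ∈ J`; then `j *
k` normalizes `P`, so it lies in `P`. -/
theorem mem_of_conj_sylow_le {p : ℕ} [Fact p.Prime] {G : Type*} [Group G] [Finite G]
    {P : Sylow p G} (hP : Subgroup.normalizer (P : Set G) = (P : Subgroup G)) {J : Subgroup G}
    (hPJ : (P : Subgroup G) ≤ J) {k : G} (hk : ∀ x ∈ P, k * x * k⁻¹ ∈ J) : k ∈ J := by
  have hkJ : ((k • P : Sylow p G) : Subgroup G) ≤ J := by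
    intro y hy
    obtain ⟨x, hx, rfl⟩ := hy
    exact hk x hx
  obtain ⟨j, hj⟩ := MulAction.exists_smul_eq J ((k • P).subtype hkJ) (P.subtype hPJ)
  simp_rw [Sylow.smul_subtype, Subgroup.smul_def, smul_smul] at hj
  have hmem : (j : G) * k ∈ P := by
    have := Sylow.smul_eq_iff_mem_normalizer.1 (Sylow.subtype_injective hj)
    rwa [hP] at this
  have := J.mul_mem (J.inv_mem j.2) (hPJ hmem)
  simpa using this

theorem le_ker_of_coprime {p : ℕ} [Fact p.Prime] {G V : Type*} [Group G] [Finite G]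
    [AddCommGroup V] [Module ℂ V] [FiniteDimensional ℂ V] {ρ : Representation ℂ G V}
    (hρ : ρ.IsIrreducible) (hdim : ¬ p ∣ finrank ℂ V)
    {P : Sylow p G} (hP : Subgroup.normalizer (P : Set G) = (P : Subgroup G)) {K : Subgroup G}
    [K.Normal] {m : ℕ} (hm : m.Coprime p) (hK : ∀ k ∈ K, ρ k ^ m = 1) : K ≤ MonoidHom.ker ρ := by
  classical
  -- The orbit count runs over the image of `K`, because only there is the exponent known to divide
  -- `m`.
  let Y : Set (End ℂ V) := ρ '' K
  have hY : Finite Y := (Set.toFinite (K : Set G)).image ρ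
  have : Fintype Y := Fintype.ofFinite Y
  let A : MulAction P Y :=
    { smul := fun g a => ⟨ρ g * a * ρ (g : G)⁻¹, by
        obtain ⟨k, hk, hka⟩ := a.2
        exact ⟨g * k * (g : G)⁻¹, Subgroup.Normal.conj_mem ‹_› k hk g, by
          rw [map_mul, map_mul, hka]⟩⟩
      one_smul := fun a => Subtype.ext (by
        change ρ (1 : G) * a * ρ (1 : G)⁻¹ = a
        simp)
      mul_smul := fun g h a => Subtype.ext (by
        change ρ (g * h : G) * a * ρ (g * h : G)⁻¹ = ρ g * (ρ h * a * ρ (h : G)⁻¹) * ρ (g : G)⁻¹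
        rw [mul_inv_rev, map_mul, map_mul]
        simp only [mul_assoc]) }
  have hsmul : ∀ (g : P) (a : Y), ((g • a : Y) : End ℂ V) = ρ g * a * ρ (g : G)⁻¹ :=
    fun _ _ => rfl
  have hinv : ∀ g : G, ρ g * ρ g⁻¹ = 1 := fun g => by rw [← map_mul, mul_inv_cancel, map_one]
  have hinv' : ∀ g : G, ρ g⁻¹ * ρ g = 1 := fun g => by rw [← map_mul, inv_mul_cancel, map_one]
  let x₀ : Y := ⟨1, 1, K.one_mem, map_one ρ⟩
  have hfix : MulAction.fixedPoints P Y = {x₀} := by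
    ext a
    rw [MulAction.mem_fixedPoints, Set.mem_singleton_iff]
    constructor
    · intro ha
      obtain ⟨k, hk, hka⟩ := a.2
      have hcomm : ∀ x ∈ P, ρ x * ρ k = ρ k * ρ x := fun x hx => by
        have := congrArg Subtype.val (ha ⟨x, hx⟩)
        rw [hsmul, ← hka] at this
        calc ρ x * ρ k = ρ x * ρ k * ρ x⁻¹ * ρ x := by rw [mul_assoc _ (ρ x⁻¹), hinv', mul_one]
          _ = ρ k * ρ x := by rw [this]
      -- Commuting with `ρ P` means that `k` conjugates `P` into `P ⊔ ker ρ`, so `k` lies there.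
      -- Then `ρ k` has `p`-power order as well as order dividing `m`, hence is trivial.
      have hkJ : k ∈ (P : Subgroup G) ⊔ MonoidHom.ker ρ := by
        refine mem_of_conj_sylow_le hP le_sup_left fun x hx => ?_
        rw [← mul_inv_cancel_left x (k * x * k⁻¹)]
        refine Subgroup.mul_mem_sup hx ?_
        rw [MonoidHom.mem_ker, map_mul, map_mul, map_mul, ← hcomm x hx, mul_assoc (ρ x), hinv,
          mul_one, hinv']
      obtain ⟨x, hx, r, hr, rfl⟩ := (Subgroup.mem_sup_of_normal_right).1 hkJ
      have hxa : ρ x = a := by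
        rw [← hka, map_mul, MonoidHom.mem_ker.1 hr, mul_one]
      obtain ⟨j, hj⟩ := P.2 ⟨x, hx⟩
      have hj' : (a : End ℂ V) ^ p ^ j = 1 := by
        rw [← hxa, ← map_pow, show x ^ p ^ j = 1 from congrArg Subtype.val hj, map_one]
      have hm' : (a : End ℂ V) ^ m = 1 := hka ▸ hK _ hk
      refine Subtype.ext ?_
      have h := orderOf_dvd_of_pow_eq_one hj'
      have h' := orderOf_dvd_of_pow_eq_one hm'
      exact orderOf_eq_one_iff.1 (Nat.eq_one_of_dvd_coprimes (hm.pow_right j) h' h)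
    · rintro rfl g
      exact Subtype.ext (by rw [hsmul, mul_one, hinv])
  obtain ⟨β, hβ, hsum⟩ := exists_sum_eq_add_prime_mul (p := p) P.2
    (f := fun a : Y => LinearMap.trace ℂ V a)
    (fun g a => by
      rw [hsmul, LinearMap.trace_mul_comm, ← mul_assoc, hinv', one_mul])
    (fun a => by
      obtain ⟨k, hk, hka⟩ := a.2
      refine isIntegral_trace_of_pow_eq_one (n := Nat.card G) Nat.card_pos.ne' ?_
      rw [← hka, ← map_pow, pow_card_eq_one', map_one]) hfix
  have hinvt : ∀ k ∈ K, ρ k * (∑ a : Y, (a : End ℂ V)) = ∑ a : Y, (a : End ℂ V) := by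
    intro k hk
    rw [Finset.mul_sum]
    have hmem : ∀ k ∈ K, ∀ a : Y, ρ k * a ∈ Y := by
      intro k hk a
      obtain ⟨l, hl, hla⟩ := a.2
      exact ⟨k * l, K.mul_mem hk hl, by rw [map_mul, hla]⟩
    refine Fintype.sum_equiv
      ⟨fun a => ⟨ρ k * a, hmem k hk a⟩, fun a => ⟨ρ k⁻¹ * a, hmem _ (K.inv_mem hk) a⟩,
        fun a => Subtype.ext ?_, fun a => Subtype.ext ?_⟩ _ _ fun a => rfl
    · simp only [← mul_assoc, hinv', one_mul]
    · simp only [← mul_assoc, hinv, one_mul]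
  let F : Submodule ℂ V := weightSpace (fun k : K => ρ k) 1
  have hF : ∀ v, v ∈ F ↔ ∀ k ∈ K, ρ k v = v := fun v => by
    simp [F, mem_weightSpace]
  rcases (isIrreducible_iff.1 hρ).2 F (fun g w hw => by
    rw [hF] at hw ⊢
    intro k hk
    have e : ρ k (ρ g w) = ρ g (ρ (g⁻¹ * k * g⁻¹⁻¹) w) := by
      simp only [← Module.End.mul_apply, ← map_mul]
      congr 2
      group
    rw [e, hw _ (Subgroup.Normal.conj_mem ‹_› k hk g⁻¹)]) with h | h
  · exfalso
    have hzero : ∑ a : Y, (a : End ℂ V) = 0 := by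
      ext v
      have : (∑ a : Y, (a : End ℂ V)) v ∈ F := by
        rw [hF]
        intro k hk
        rw [← Module.End.mul_apply, hinvt k hk]
      rw [h] at this
      exact (Submodule.mem_bot ℂ).1 this
    have h0 : (finrank ℂ V : ℂ) + p * β = 0 := by
      rw [← map_sum, hzero, map_zero] at hsum
      rw [hsum]
      simp [x₀]
    have hp0 : (p : ℂ) ≠ 0 := by exact_mod_cast (Fact.out : p.Prime).ne_zero
    -- The sum of the operators vanishes, so `β = -dim V / p` is a rational algebraic integer, hence
    -- an integer, against `p ∤ dim V`.
    have hβ' : β = ((-(finrank ℂ V : ℚ) / p : ℚ) : ℂ) := by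
      push_cast
      field_simp
      linear_combination h0
    rw [hβ'] at hβ
    have hq : IsIntegral ℤ (-(finrank ℂ V : ℚ) / p : ℚ) :=
      (isIntegral_algebraMap_iff (algebraMap ℚ ℂ).injective).1 hβ
    obtain ⟨z, hz⟩ := IsIntegrallyClosed.isIntegral_iff.1 hq
    have hp0' : (p : ℚ) ≠ 0 := by exact_mod_cast (Fact.out : p.Prime).ne_zero
    apply hdim
    rw [← Int.natCast_dvd_natCast]
    refine ⟨-z, ?_⟩
    have : (finrank ℂ V : ℚ) = p * -z := by
      have hz' : (z : ℚ) = -(finrank ℂ V : ℚ) / p := hz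
      rw [hz']
      field_simp
    exact_mod_cast this
  · intro k hk
    rw [MonoidHom.mem_ker]
    ext v
    exact (hF v).1 (h ▸ Submodule.mem_top) k hk

end Coprime

/-! ### Exponent series, Sylow normalizers and commuting normal subgroups -/

section Series

/-- `G` has a normal series in which the exponent of every factor divides a power of `p` or a
number coprime to `p`. -/
def HasExponentSeries (p : ℕ) (G : Type*) [Group G] : Prop :=
  ∃ (r : ℕ) (N : ℕ → Subgroup G), N 0 = ⊥ ∧ N r = ⊤ ∧ (∀ i ≤ r, (N i).Normal) ∧
    ∀ i < r, ∃ m : ℕ, ((∃ k, m = p ^ k) ∨ m.Coprime p) ∧ ∀ g ∈ N (i + 1), g ^ m ∈ N i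

variable {p : ℕ} {G : Type*} [Group G]

theorem IsPSolvable.hasExponentSeries (hG : IsPSolvable p G) : HasExponentSeries p G := by
  obtain ⟨r, N, h0, hr, hN, hi⟩ := hG
  refine ⟨r, N, h0, hr, hN, fun i hir => ⟨(N i).relIndex (N (i + 1)), (hi i hir).2, ?_⟩⟩
  have := hN i hir.le
  exact fun g hg => (N i).pow_relIndex_mem hg

/-- Intersecting with `T` keeps the same exponents `m`. This is why exponents replace the orders of
the factors. -/
theorem HasExponentSeries.subgroup (hG : HasExponentSeries p G) (T : Subgroup G) :
    HasExponentSeries p T := by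
  obtain ⟨r, N, h0, hr, hN, hi⟩ := hG
  refine ⟨r, fun i => (N i).subgroupOf T, by simp [h0], by simp [hr], fun i hir => ?_,
    fun i hir => ?_⟩
  · have := hN i hir
    infer_instance
  · obtain ⟨m, hm, h⟩ := hi i hir
    exact ⟨m, hm, fun g hg => h g hg⟩

/-- Since `p` does not divide the index of `T`, a Sylow `p`-subgroup of `T` is one of `G`. -/
theorem normalizer_eq_of_index_coprime [Fact p.Prime] [Finite G]
    (hG : ∀ P : Sylow p G, Subgroup.normalizer (P : Set G) = (P : Subgroup G))
    {T : Subgroup G} (hT : ¬ p ∣ T.index) (Q : Sylow p T) :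
    Subgroup.normalizer (Q : Set T) = (Q : Subgroup T) := by
  have hidx : ¬ p ∣ ((Q : Subgroup T).map T.subtype).index := by
    rw [Subgroup.index_map_subtype, (Fact.out : p.Prime).dvd_mul, not_or]
    exact ⟨Q.not_dvd_index, hT⟩
  have hP := hG ((Q.2.map T.subtype).toSylow hidx)
  refine le_antisymm (fun t ht => ?_) Subgroup.le_normalizer
  have : (t : G) ∈ Subgroup.normalizer
      (((Q.2.map T.subtype).toSylow hidx : Sylow p G) : Set G) := by
    have hmem : ∀ s : T, (s : G) ∈ (Q : Subgroup T).map T.subtype ↔ s ∈ (Q : Subgroup T) :=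
      fun s => Subgroup.mem_map_iff_mem T.subtype_injective
    refine Subgroup.mem_normalizer_iff.2 fun h => ?_
    by_cases hh : h ∈ T
    · exact ((hmem ⟨h, hh⟩).trans (Subgroup.mem_normalizer_iff.1 ht ⟨h, hh⟩)).trans
        (hmem (t * ⟨h, hh⟩ * t⁻¹)).symm
    · refine iff_of_false (fun h' => hh (Subgroup.map_subtype_le _ h')) fun h' => hh ?_
      have := T.mul_mem (T.mul_mem (T.inv_mem t.2) (Subgroup.map_subtype_le _ h')) t.2
      simpa [mul_assoc] using this
  rw [hP] at this
  obtain ⟨s, hs, hst⟩ := this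
  exact (Subtype.ext hst : s = t) ▸ hs

/-- The image of `K` is a nontrivial finite `p`-group, so its centre is nontrivial; `L` is the
preimage of that centre in `K`. -/
theorem exists_commuting_normal [Fact p.Prime] [Finite G] {V : Type*} [AddCommGroup V]
    [Module ℂ V] {ρ : Representation ℂ G V} {K : Subgroup G} [K.Normal]
    (hK : ¬ K ≤ MonoidHom.ker ρ) {e : ℕ} (hKe : ∀ k ∈ K, ρ k ^ p ^ e = 1) :
    ∃ L ≤ K, L.Normal ∧ ¬ L ≤ MonoidHom.ker ρ ∧ ∀ k ∈ L, ∀ l ∈ L, Commute (ρ k) (ρ l) := by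
  let φ : K →* (V →ₗ[ℂ] V)ˣ := ρ.asGroupHom.comp K.subtype
  have hφ : ∀ k : K, (φ k : End ℂ V) = ρ k := fun k => rfl
  have hp : IsPGroup p φ.range := by
    rintro ⟨_, k, rfl⟩
    refine ⟨e, Subtype.ext (Units.ext ?_)⟩
    exact hKe k k.2
  have hnt : Nontrivial φ.range := by
    obtain ⟨k, hk, hk'⟩ := SetLike.not_le_iff_exists.1 hK
    refine ⟨⟨⟨φ ⟨k, hk⟩, ⟨k, hk⟩, rfl⟩, 1, fun h => hk' ?_⟩⟩
    exact congrArg (fun x : φ.range => ((x : (V →ₗ[ℂ] V)ˣ) : End ℂ V)) h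
  have : Finite φ.range := Set.finite_range φ
  have := hp.center_nontrivial
  obtain ⟨⟨⟨_, z, rfl⟩, hz⟩, hz1⟩ := exists_ne (1 : Subgroup.center φ.range)
  refine ⟨
    { carrier := {k | k ∈ K ∧ ∀ l ∈ K, Commute (ρ k) (ρ l)}
      one_mem' := ⟨K.one_mem, fun l _ => by rw [map_one]; exact Commute.one_left _⟩
      mul_mem' := fun ha hb => ⟨K.mul_mem ha.1 hb.1, fun l hl => by
        rw [map_mul]; exact (ha.2 l hl).mul_left (hb.2 l hl)⟩
      inv_mem' := fun {a} ha => ⟨K.inv_mem ha.1, fun l hl => by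
        have h := ha.2 l hl
        have h1 : ρ a⁻¹ * ρ a = 1 := by rw [← map_mul, inv_mul_cancel, map_one]
        have h2 : ρ a * ρ a⁻¹ = 1 := by rw [← map_mul, mul_inv_cancel, map_one]
        calc ρ a⁻¹ * ρ l = ρ a⁻¹ * (ρ l * ρ a) * ρ a⁻¹ := by simp only [mul_assoc, h2, mul_one]
          _ = ρ l * ρ a⁻¹ := by rw [← h.eq, ← mul_assoc, h1, one_mul]⟩ },
    fun k hk => hk.1, ⟨fun k hk g => ⟨Subgroup.Normal.conj_mem ‹_› k hk.1 g, fun l hl => ?_⟩⟩,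
    fun h => hz1 ?_, fun k hk l hl => hk.2 l hl.1⟩
  · have := hk.2 _ (Subgroup.Normal.conj_mem ‹_› l hl g⁻¹)
    have h3 := congrArg (fun x => ρ g * x * ρ g⁻¹) this.eq
    simp only [← map_mul] at h3
    change ρ _ * ρ _ = ρ _ * ρ _
    rw [← map_mul, ← map_mul]
    convert h3 using 2 <;> group
  · have hzL := h (show (z : G) ∈ _ from ⟨z.2, fun l hl => by
      have := Subgroup.mem_center_iff.1 hz ⟨φ ⟨l, hl⟩, ⟨l, hl⟩, rfl⟩
      exact (congrArg (fun x : φ.range => ((x : (V →ₗ[ℂ] V)ˣ) : End ℂ V)) this).symm⟩)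
    exact Subtype.ext (Subtype.ext (Units.ext hzL))

end Series

/-! ### Tensoring with linear characters -/

section Twist

variable {G V : Type*} [Group G] [AddCommGroup V] [Module ℂ V]

/-- The tensor product of a representation with a linear character. -/
def twist (c : G →* ℂˣ) (ρ : Representation ℂ G V) : Representation ℂ G V where
  toFun g := (c g : ℂ) • ρ g
  map_one' := by simp
  map_mul' g h := by
    rw [map_mul, map_mul, smul_mul_smul_comm, Units.val_mul]

theorem twist_apply (c : G →* ℂˣ) (ρ : Representation ℂ G V) (g : G) :
    twist c ρ g = (c g : ℂ) • ρ g := rfl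

theorem isIrreducible_twist (c : G →* ℂˣ) {ρ : Representation ℂ G V} (hρ : ρ.IsIrreducible) :
    (twist c ρ).IsIrreducible := by
  rw [isIrreducible_iff] at hρ ⊢
  refine ⟨hρ.1, fun W hW => hρ.2 W fun g w hw => ?_⟩
  have := W.smul_mem ((c g)⁻¹ : ℂˣ) (hW g w hw)
  rwa [twist_apply, LinearMap.smul_apply, smul_smul, Units.inv_mul,
    one_smul] at this

theorem IsTwisted.twist {U : Type*} [AddCommGroup U] [Module ℂ U] {N : Subgroup G} [N.Normal]
    {σ : Representation ℂ N U} {g : G} {Y : End ℂ U} (hY : IsTwisted σ g Y) (c : G →* ℂˣ) :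
    IsTwisted (CharExt.twist (c.comp N.subtype) σ) g Y := fun n => by
  have : c.comp N.subtype (MulAut.conjNormal g n) = c.comp N.subtype n := by
    simp
  rw [twist_apply, twist_apply, this, mul_smul_comm, hY, smul_mul_assoc]

end Twist

/-! ### Representations on stable subspaces -/

section SubRep

variable {G G' V : Type*} [Group G] [Group G'] [AddCommGroup V] [Module ℂ V]

/-- The representation of `G'` on a subspace that is stable under its image in `G`. -/
def subRep (ρ : Representation ℂ G V) (φ : G' →* G) (E : Submodule ℂ V)
    (h : ∀ x, ∀ v ∈ E, ρ (φ x) v ∈ E) : Representation ℂ G' E where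
  toFun x := (ρ (φ x)).restrict (h x)
  map_one' := by ext; simp
  map_mul' x y := by ext; simp

theorem isIrreducible_subRep {ρ : Representation ℂ G V} {φ : G' →* G} {E : Submodule ℂ V}
    (h : ∀ x, ∀ v ∈ E, ρ (φ x) v ∈ E) (hE : E ≠ ⊥)
    (hirr : ∀ W ≤ E, W ≠ ⊥ → (∀ x, ∀ w ∈ W, ρ (φ x) w ∈ W) → W = E) :
    (subRep ρ φ E h).IsIrreducible := by
  refine isIrreducible_iff.2 ⟨Submodule.nontrivial_iff_ne_bot.2 hE, fun W hW => ?_⟩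
  by_cases h0 : W = ⊥
  · exact Or.inl h0
  · refine Or.inr (Submodule.map_injective_of_injective E.injective_subtype ?_)
    rw [Submodule.map_top, Submodule.range_subtype]
    refine hirr _ (Submodule.map_subtype_le _ _) (fun hb => h0
      (Submodule.map_injective_of_injective E.injective_subtype
        (hb.trans (Submodule.map_bot _).symm))) ?_
    rintro x _ ⟨w, hw, rfl⟩
    exact ⟨subRep ρ φ E h x w, hW x w hw, rfl⟩

end SubRep

/-! ### Conjugation on weights -/

section ConjAct

variable {G : Type*} [Group G]

/-- The action of `G` by conjugation on functions on a normal subgroup. -/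
def conjFun (K : Subgroup G) [K.Normal] : G →* Equiv.Perm (K → ℂ) where
  toFun g := (MulAut.conjNormal g).toEquiv.arrowCongr (Equiv.refl ℂ)
  map_one' := by rw [map_one]; rfl
  map_mul' g h := by
    ext μ k
    rw [map_mul]
    rfl

theorem conjFun_apply (K : Subgroup G) [K.Normal] (g : G) (μ : K → ℂ) (k : K) :
    conjFun K g μ (MulAut.conjNormal g k) = μ k := by
  simp [conjFun]

theorem map_weightSpace_le {K : Subgroup G} [K.Normal] {V : Type*} [AddCommGroup V] [Module ℂ V]
    {f : K → End ℂ V} {g : G} {Y : End ℂ V} (hY : ∀ k, Y * f k = f (MulAut.conjNormal g k) * Y)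
    (μ : K → ℂ) : (weightSpace f μ).map Y ≤ weightSpace f (conjFun K g μ) := by
  rintro _ ⟨v, hv, rfl⟩
  rw [SetLike.mem_coe, mem_weightSpace] at hv
  rw [mem_weightSpace]
  intro l
  obtain ⟨k, rfl⟩ := (MulAut.conjNormal g).surjective l
  rw [conjFun_apply, ← Module.End.mul_apply, ← hY, Module.End.mul_apply, hv, map_smul]

end ConjAct

/-- Every irreducible representation `σ` of a normal subgroup `N` of `G` that embeds into an
irreducible representation of `G` of degree prime to `p` extends to every subgroup `H ≥ N` that
leaves `σ` invariant. -/
def ExtensionProperty (p : ℕ) (G : Type*) [Group G] : Prop :=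
  ∀ (V U : Type) [AddCommGroup V] [Module ℂ V] [FiniteDimensional ℂ V] [AddCommGroup U]
    [Module ℂ U] [FiniteDimensional ℂ U] (N H : Subgroup G) [N.Normal] (hNH : N ≤ H)
    (ρ : Representation ℂ G V) (σ : Representation ℂ N U) (f : U →ₗ[ℂ] V),
    ρ.IsIrreducible → σ.IsIrreducible → ¬ p ∣ finrank ℂ V → Function.Injective f →
    (∀ (n : N) (u : U), f (σ n u) = ρ n (f u)) →
    (∀ h ∈ H, ∃ Y, Y ≠ 0 ∧ IsTwisted σ h Y) →
    ∃ τ : Representation ℂ H U, ∀ n : N, τ (Subgroup.inclusion hNH n) = σ n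

/-! ### The two reductions: weight stabilizers and scalar action -/

section Step

variable {p : ℕ} {G V U : Type*} [Group G] [AddCommGroup V] [Module ℂ V]
  [AddCommGroup U] [Module ℂ U]

theorem map_weightSpace_rep_le (ρ : Representation ℂ G V) (K : Subgroup G) [K.Normal] (g : G)
    (μ : K → ℂ) : (weightSpace (fun k : K => ρ k) μ).map (ρ g) ≤
      weightSpace (fun k : K => ρ k) (conjFun K g μ) := by
  refine map_weightSpace_le (fun k => ?_) μ
  rw [← map_mul, ← map_mul]
  congr 1
  simp

theorem map_weightSpace_twisted_le {N K : Subgroup G} [N.Normal] [K.Normal] (hKN : K ≤ N)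
    {σ : Representation ℂ N U} {g : G} {Y : End ℂ U} (hY : IsTwisted σ g Y) (μ : K → ℂ) :
    (weightSpace (fun k : K => σ (Subgroup.inclusion hKN k)) μ).map Y ≤
      weightSpace (fun k : K => σ (Subgroup.inclusion hKN k)) (conjFun K g μ) := by
  refine map_weightSpace_le (fun k => ?_) μ
  rw [hY]
  congr 2

/-- Reduction to the stabilizer of a weight. -/
theorem exists_extension_of_weight {V U : Type} [AddCommGroup V] [Module ℂ V]
    [FiniteDimensional ℂ V] [AddCommGroup U] [Module ℂ U] [FiniteDimensional ℂ U]
    {N H K : Subgroup G} [N.Normal] [K.Normal] (hNH : N ≤ H) (hKN : K ≤ N)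
    {ρ : Representation ℂ G V} {σ : Representation ℂ N U} {f : U →ₗ[ℂ] V}
    (hρ : ρ.IsIrreducible) (hσ : σ.IsIrreducible) (hf : Function.Injective f)
    (hfσ : ∀ (n : N) (u : U), f (σ n u) = ρ n (f u))
    (hX : ∀ h ∈ H, ∃ Y, Y ≠ 0 ∧ IsTwisted σ h Y)
    (hK : ∀ k ∈ K, ∀ l ∈ K, Commute (ρ k) (ρ l))
    (hKσ : ∀ k l : K, Commute (σ (Subgroup.inclusion hKN k)) (σ (Subgroup.inclusion hKN l)))
    {μ : K → ℂ} (hμ : weightSpace (fun k : K => σ (Subgroup.inclusion hKN k)) μ ≠ ⊥)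
    (hdim : ¬ p ∣ finrank ℂ (weightSpace (fun k : K => ρ k) μ))
    (hT : ExtensionProperty p (actStabilizer (conjFun K) μ)) :
    ∃ τ : Representation ℂ H U, ∀ n : N, τ (Subgroup.inclusion hNH n) = σ n := by
  set T := actStabilizer (conjFun K) μ with hTdef
  set EU := weightSpace (fun k : K => σ (Subgroup.inclusion hKN k)) with hEU
  set EV := weightSpace (fun k : K => ρ k) with hEV
  have hfE : ∀ u ∈ EU μ, f u ∈ EV μ := fun u hu => by
    rw [hEV, mem_weightSpace]
    rw [hEU, mem_weightSpace] at hu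
    intro k
    rw [← map_smul, ← hu k, hfσ]
    rfl
  have hμV : EV μ ≠ ⊥ := by
    obtain ⟨u, hu, hu0⟩ := Submodule.exists_mem_ne_zero_of_ne_bot hμ
    refine (Submodule.ne_bot_iff _).2 ⟨f u, hfE u hu, fun h => hu0 (hf ?_)⟩
    rw [h, map_zero]
  have hUind : iSupIndep EU := iSupIndep_weightSpace hKσ
  have hVind : iSupIndep EV := iSupIndep_weightSpace fun k l => hK k k.2 l l.2
  have hUact : ∀ (n : N) (ν : K → ℂ), (EU ν).map (σ n) ≤ EU ((conjFun K).comp N.subtype n ν) :=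
    fun n ν => map_weightSpace_twisted_le hKN (isTwisted_apply n) ν
  have hVact : ∀ (g : G) (ν : K → ℂ), (EV ν).map (ρ g) ≤ EV (conjFun K g ν) :=
    fun g ν => map_weightSpace_rep_le ρ K g ν
  have hXE : ∀ h ∈ H, h ∈ T → ∀ Y, IsTwisted σ h Y → ∀ u ∈ EU μ, Y u ∈ EU μ := by
    intro h _ hhT Y hY u hu
    have := map_weightSpace_twisted_le hKN hY μ (Submodule.mem_map_of_mem hu)
    rwa [mem_actStabilizer.1 hhT] at this
  have hNE : ∀ n : N.subgroupOf T, ∀ u ∈ EU μ, σ (T.subtype.subgroupComap N n) u ∈ EU μ :=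
    fun n u hu => hXE _ (hNH n.2) n.1.2 _ (isTwisted_apply (T.subtype.subgroupComap N n)) u hu
  have hTE : ∀ t : T, ∀ v ∈ EV μ, ρ (T.subtype t) v ∈ EV μ := by
    intro t v hv
    have := hVact t μ (Submodule.mem_map_of_mem hv)
    rwa [mem_actStabilizer.1 t.2] at this
  have hEirr : ∀ W ≤ EU μ, W ≠ ⊥ → (∀ n : N, (n : G) ∈ T → ∀ w ∈ W, σ n w ∈ W) → W = EU μ :=
    fun W hW hW0 h => eq_of_le_of_stable hσ hUind hUact hW hW0 fun n hn => h n hn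
  obtain ⟨τ', hτ'⟩ := hT (EV μ) (EU μ) (N.subgroupOf T) (H.subgroupOf T)
    (Subgroup.comap_mono hNH) (subRep ρ T.subtype (EV μ) hTE)
    (subRep σ (T.subtype.subgroupComap N) (EU μ) hNE) (f.restrict hfE)
    (isIrreducible_subRep hTE hμV fun W hW hW0 h =>
      eq_of_le_of_stable hρ hVind hVact hW hW0 fun g hg => h ⟨g, hg⟩)
    (isIrreducible_subRep hNE hμ fun W hW hW0 h =>
      hEirr W hW hW0 fun n hn => h ⟨⟨n, hn⟩, n.2⟩)
    hdim
    (fun u v huv => Subtype.ext (hf (congrArg Subtype.val huv)))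
    (fun n u => Subtype.ext (hfσ _ _))
    (by
      intro h hh
      obtain ⟨Y, hY0, hY⟩ := hX h hh
      refine ⟨Y.restrict (hXE h hh h.2 Y hY), fun h0 => ?_, fun n => ?_⟩
      · obtain ⟨u, hu, hu0⟩ := Submodule.exists_mem_ne_zero_of_ne_bot hμ
        exact hY0 (hY.eq_zero hσ hu0 (congrArg Subtype.val (LinearMap.congr_fun h0 ⟨u, hu⟩)))
      · refine LinearMap.ext fun u => Subtype.ext ?_
        exact LinearMap.congr_fun (hY (T.subtype.subgroupComap N n)) u)
  refine exists_extension_of_subspace hNH hσ hμ hEirr hX hXE (fun h hh => ?_) τ' fun n hn u => ?_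
  · obtain ⟨Y, hY0, hY⟩ := hX h hh
    have hne : EU (conjFun K h μ) ≠ ⊥ := by
      obtain ⟨u, hu, hu0⟩ := Submodule.exists_mem_ne_zero_of_ne_bot hμ
      exact (Submodule.ne_bot_iff _).2 ⟨Y u, map_weightSpace_twisted_le hKN hY μ
        (Submodule.mem_map_of_mem hu), fun h => hY0 (hY.eq_zero hσ hu0 h)⟩
    -- Frattini argument: the conjugate of `μ` by `h` is again a weight of `U`, and `N` permutes the
    -- weights of the irreducible `σ` transitively.
    obtain ⟨n, hn⟩ := exists_act_eq hσ hUind hUact hne hμ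
    refine ⟨n, ?_⟩
    rw [hTdef, mem_actStabilizer, map_mul, Equiv.Perm.mul_apply]
    exact hn
  · exact congrArg Subtype.val (LinearMap.congr_fun (hτ' ⟨⟨n, hn⟩, n.2⟩) u)

/-- A linear character of `G` that agrees on `K` with the scalars by which `K` acts. -/
theorem exists_character_of_scalar [Fact p.Prime] [FiniteDimensional ℂ V] {ρ : Representation ℂ G V}
    [Nontrivial V] (hdim : ¬ p ∣ finrank ℂ V) {K : Subgroup G} {μ : K → ℂ} (hμ : ∀ k : K, ρ k = μ k • 1) {e : ℕ}
    (hKe : ∀ k ∈ K, ρ k ^ p ^ e = 1) :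
    ∃ c : G →* ℂˣ, (∀ g, ρ g = 1 → c g = 1) ∧ ∀ k : K, (c k : ℂ) = μ k := by
  have hcop : (finrank ℂ V).Coprime (p ^ e) :=
    (((Fact.out : p.Prime).coprime_iff_not_dvd.2 hdim).symm).pow_right e
  have hpow : ∀ k : K, μ k ^ p ^ e = 1 := fun k => by
    have h := hKe k k.2
    rw [hμ, smul_pow, one_pow] at h
    obtain ⟨v, hv⟩ := exists_ne (0 : V)
    have h' := LinearMap.congr_fun h v
    have : (μ k ^ p ^ e - 1) • v = 0 := by
      rw [sub_smul, one_smul, sub_eq_zero]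
      simpa using h'
    exact sub_eq_zero.1 ((smul_eq_zero.1 this).resolve_right hv)
  -- On `K` the determinant of `ρ` is `μ ^ dim V`. The exponent `j` inverts `dim V` modulo `p ^ e`,
  -- and the values of `μ` are `p ^ e`-th roots of unity, so `det ^ j` equals `μ` there.
  obtain ⟨j, -, hj⟩ := Nat.exists_mul_mod_eq_of_coprime 1 hcop
    (pow_ne_zero e (Fact.out : p.Prime).ne_zero)
  refine ⟨((LinearMap.det.comp ρ).toHomUnits) ^ j, fun g hg => ?_, fun k => ?_⟩
  · ext
    simp [hg]
  · have : ((((LinearMap.det.comp ρ).toHomUnits) ^ j) k : ℂ) = LinearMap.det (ρ k) ^ j := by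
      simp
    rw [this, hμ, LinearMap.det_smul, map_one, mul_one, ← pow_mul,
      pow_eq_pow_mod _ (hpow k), hj, ← pow_eq_pow_mod _ (hpow k), pow_one]

theorem not_dvd_of_index_mul {T : Subgroup G} {a b : ℕ} (h : a = T.index * b)
    (ha : ¬ p ∣ a) : ¬ p ∣ T.index ∧ ¬ p ∣ b :=
  ⟨fun h' => ha (h ▸ h'.mul_right _), fun h' => ha (h ▸ h'.mul_left _)⟩

end Step

/-! ### The induction -/

theorem extensionProperty_of_subgroups {p : ℕ} [Fact p.Prime] {G : Type*} [Group G] [Finite G]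
    (hG : HasExponentSeries p G)
    (hP : ∀ P : Sylow p G, Subgroup.normalizer (P : Set G) = (P : Subgroup G))
    (ih : ∀ T : Subgroup G, T ≠ ⊤ → ¬ p ∣ T.index → ExtensionProperty p T) :
    ExtensionProperty p G := by
  intro V U _ _ _ _ _ _ N H _ hNH ρ σ f hρ hσ hdim hf hfσ hX
  -- Inner induction, for the case where `K` acts by scalars: twisting changes `ρ` and `σ` but keeps
  -- the spaces, `f`, `N` and `H`, and enlarges `ker ρ ⊓ N`.
  induction hq : Nat.card G - Nat.card (MonoidHom.ker ρ ⊓ N : Subgroup G)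
    using Nat.strong_induction_on generalizing ρ σ with | _ q ihq => ?_
  have hUnt : Nontrivial U := (isIrreducible_iff.1 hσ).1
  have hVnt : Nontrivial V := (isIrreducible_iff.1 hρ).1
  have hσ1 : ∀ n : N, ρ n = 1 → σ n = 1 := fun n hn => LinearMap.ext fun u => hf (by
    rw [hfσ, hn]; rfl)
  by_cases hN : N ≤ MonoidHom.ker ρ
  · exact ⟨1, fun n => (hσ1 n (hN n.2)).symm⟩
  obtain ⟨r, S, hS0, hSr, hSn, hS⟩ := hG
  have hex : ∃ i, ¬ N ⊓ S i ≤ MonoidHom.ker ρ := ⟨r, by rwa [hSr, inf_top_eq]⟩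
  classical
  obtain ⟨i, hi⟩ : ∃ i, Nat.find hex = i + 1 := by
    refine Nat.exists_eq_succ_of_ne_zero fun h0 => Nat.find_spec hex ?_
    rw [h0, hS0, inf_bot_eq]
    exact bot_le
  have hir : i < r := by
    have := Nat.find_min' hex (m := r) (by rwa [hSr, inf_top_eq])
    omega
  -- Minimality of `i + 1` turns the exponent of the factor `S (i + 1) / S i` into an exponent of
  -- the image of `N ⊓ S (i + 1)` under `ρ`.
  have hlow : N ⊓ S i ≤ MonoidHom.ker ρ := not_not.1 (Nat.find_min hex (by omega))
  have hhigh : ¬ N ⊓ S (i + 1) ≤ MonoidHom.ker ρ := hi ▸ Nat.find_spec hex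
  have hSn' : (S (i + 1)).Normal := hSn _ hir
  obtain ⟨m, hm, hpow⟩ := hS i hir
  have hexp : ∀ k ∈ N ⊓ S (i + 1), ρ k ^ m = 1 := fun k hk => by
    rw [← map_pow]
    exact hlow ⟨N.pow_mem hk.1 m, hpow k hk.2⟩
  rcases hm with ⟨e, rfl⟩ | hm
  swap
  · exact absurd (le_ker_of_coprime hρ hdim (hP default) hm hexp) hhigh
  obtain ⟨K, hKle, hKn, hKker, hKcomm⟩ := exists_commuting_normal hhigh hexp
  have hKN : K ≤ N := hKle.trans inf_le_left
  have hKe : ∀ k ∈ K, ρ k ^ p ^ e = 1 := fun k hk => hexp k (hKle hk)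
  have hKσ : ∀ k l : K,
      Commute (σ (Subgroup.inclusion hKN k)) (σ (Subgroup.inclusion hKN l)) := by
    intro k l
    refine LinearMap.ext fun u => hf ?_
    simp only [Module.End.mul_apply, hfσ]
    exact LinearMap.congr_fun (hKcomm k k.2 l l.2) (f u)
  obtain ⟨μ, hμ⟩ := exists_weightSpace_ne_bot hKσ (n := p ^ e)
    (pow_ne_zero _ (Fact.out : p.Prime).ne_zero) fun k => by
      rw [← map_pow]
      refine hσ1 _ ?_
      rw [← hKe k k.2, ← map_pow]
      simp
  have hμV : weightSpace (fun k : K => ρ k) μ ≠ ⊥ := by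
    obtain ⟨u, hu, hu0⟩ := Submodule.exists_mem_ne_zero_of_ne_bot hμ
    rw [mem_weightSpace] at hu
    refine (Submodule.ne_bot_iff _).2 ⟨f u, mem_weightSpace.2 fun k => ?_, fun h => hu0 (hf ?_)⟩
    · rw [← map_smul, ← hu k, hfσ]
      rfl
    · rw [h, map_zero]
  have hVind : iSupIndep (weightSpace fun k : K => ρ k) :=
    iSupIndep_weightSpace fun k l => hKcomm k k.2 l l.2
  obtain ⟨hidx, hdimμ⟩ := not_dvd_of_index_mul
    (finrank_eq_index_mul hρ hVind (map_weightSpace_rep_le ρ K) hμV) hdim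
  by_cases hT : actStabilizer (conjFun K) μ = ⊤
  swap
  · exact exists_extension_of_weight hNH hKN hρ hσ hf hfσ hX hKcomm hKσ hμ hdimμ (ih _ hT hidx)
  have htop : weightSpace (fun k : K => ρ k) μ = ⊤ := by
    refine ((isIrreducible_iff.1 hρ).2 _ fun g w hw => ?_).resolve_left hμV
    have := map_weightSpace_rep_le ρ K g μ (Submodule.mem_map_of_mem hw)
    rwa [mem_actStabilizer.1 (hT.ge (Subgroup.mem_top g))] at this
  have hscal : ∀ k : K, ρ k = μ k • 1 := fun k => LinearMap.ext fun v =>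
    mem_weightSpace.1 (htop.ge (Submodule.mem_top (x := v))) k
  obtain ⟨c, hc1, hcμ⟩ := exists_character_of_scalar hdim hscal hKe
  have hker : MonoidHom.ker ρ ⊓ N < MonoidHom.ker (twist c⁻¹ ρ) ⊓ N := by
    refine lt_of_le_of_ne (fun g hg => ⟨?_, hg.2⟩) fun h => hKker fun k hk => ?_
    · have hg1 : ρ g = 1 := hg.1
      change twist c⁻¹ ρ g = 1
      rw [twist_apply, hg1, MonoidHom.inv_apply, hc1 g hg1]
      simp
    · refine (h.ge ⟨?_, hKN hk⟩).1
      change twist c⁻¹ ρ k = 1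
      rw [twist_apply, hscal ⟨k, hk⟩, ← hcμ ⟨k, hk⟩, smul_smul]
      simp
  have hcard : Nat.card (MonoidHom.ker ρ ⊓ N : Subgroup G) <
      Nat.card (MonoidHom.ker (twist c⁻¹ ρ) ⊓ N : Subgroup G) :=
    Set.ncard_lt_ncard hker
  have hle := Subgroup.card_le_card_group (MonoidHom.ker (twist c⁻¹ ρ) ⊓ N : Subgroup G)
  obtain ⟨τ, hτ⟩ := ihq _ (by omega) (twist c⁻¹ ρ) (twist (c⁻¹.comp N.subtype) σ)
    (isIrreducible_twist _ hρ) (isIrreducible_twist _ hσ)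
    (fun n u => by
      simp only [twist_apply, LinearMap.smul_apply, map_smul, hfσ]
      rfl)
    (fun h hh => by
      obtain ⟨Y, hY0, hY⟩ := hX h hh
      exact ⟨Y, hY0, hY.twist _⟩) rfl
  refine ⟨twist (c.comp H.subtype) τ, fun n => ?_⟩
  rw [twist_apply, hτ, twist_apply, smul_smul]
  simp

theorem extensionProperty {p : ℕ} [Fact p.Prime] {G : Type*} [Group G] [Finite G]
    (hG : HasExponentSeries p G)
    (hP : ∀ P : Sylow p G, Subgroup.normalizer (P : Set G) = (P : Subgroup G)) :
    ExtensionProperty p G := by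
  induction hm : Nat.card G using Nat.strong_induction_on generalizing G with | _ m ih => ?_
  refine extensionProperty_of_subgroups hG hP fun T hT hidx => ?_
  refine ih _ ?_ (hG.subgroup T) (normalizer_eq_of_index_coprime hP hidx) rfl
  rw [← hm]
  exact lt_of_le_of_ne (Subgroup.card_le_card_group T)
    fun h => hT (Subgroup.eq_top_of_card_eq T h)

/-! ### From characters to intertwining maps -/

section Characters

variable {G V W : Type*} [Group G] [AddCommGroup V] [Module ℂ V]
  [FiniteDimensional ℂ V] [AddCommGroup W] [Module ℂ W] [FiniteDimensional ℂ W]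

theorem sum_character_mul_inv [Fintype G] (ρ : Representation ℂ G V) (σ : Representation ℂ G W) :
    ∑ g, σ.character g * ρ.character g⁻¹ =
      Nat.card G * finrank ℂ (Representation.IntertwiningMap ρ σ) := by
  have h0 : (Nat.card G : ℂ) ≠ 0 := by exact_mod_cast Nat.card_pos.ne'
  have := invertibleOfNonzero h0
  rw [← Representation.card_inv_mul_sum_char_mul_char_eq_finrank, ← mul_assoc,
    mul_inv_cancel₀ h0, one_mul]

theorem finrank_intertwiningMap_self_ne_zero {ρ : Representation ℂ G V}
    (hρ : ρ.IsIrreducible) : finrank ℂ (Representation.IntertwiningMap ρ ρ) ≠ 0 := by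
  rw [Representation.IsIrreducible.finrank_intertwiningMap_self]
  exact one_ne_zero

theorem exists_ne_zero_of_sum_ne_zero [Fintype G] {ρ : Representation ℂ G V}
    {σ : Representation ℂ G W} (h : ∑ g, σ.character g * ρ.character g⁻¹ ≠ 0) :
    ∃ f : Representation.IntertwiningMap ρ σ, f ≠ 0 := by
  by_contra! hf
  rw [sum_character_mul_inv] at h
  have : Subsingleton (Representation.IntertwiningMap ρ σ) := ⟨fun a b => by rw [hf a, hf b]⟩
  exact h (by rw [finrank_zero_of_subsingleton]; simp)

/-- Each summand contributes the order of `G` times a natural number, so nothing cancels, and the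
contribution of `σ` itself is nonzero. -/
theorem sum_ne_zero_of_isConstituent [Fintype G] {Δ : G → ℂ} {σ : Representation ℂ G W}
    (hσ : σ.IsIrreducible) (h : IsConstituent σ.character Δ) :
    ∑ g, Δ g * σ.character g⁻¹ ≠ 0 := by
  obtain ⟨a, ha, rfl, hne⟩ := h
  have hk : ∀ φ : G → ℂ, ∃ k : ℕ, φ ∈ a.support →
      ∑ g, φ g * σ.character g⁻¹ = Nat.card G * k := fun φ => by
    by_cases hφ : φ ∈ a.support
    · obtain ⟨n, ρ, -, rfl⟩ := ha φ hφ
      exact ⟨_, fun _ => sum_character_mul_inv σ ρ⟩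
    · exact ⟨0, fun h => absurd h hφ⟩
  choose k hk using hk
  have h0 : (Nat.card G : ℂ) ≠ 0 := by exact_mod_cast Nat.card_pos.ne'
  have hσk : k σ.character ≠ 0 := by
    have h1 := hk _ (Finsupp.mem_support_iff.2 hne)
    rw [sum_character_mul_inv] at h1
    have h2 := mul_left_cancel₀ h0 h1
    rw [← Nat.cast_injective h2]
    exact finrank_intertwiningMap_self_ne_zero hσ
  have hsum : ∑ g, (a.sum fun φ m => m • φ) g * σ.character g⁻¹ =
      Nat.card G * ((∑ φ ∈ a.support, a φ * k φ : ℕ) : ℂ) := by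
    simp only [Finsupp.sum, Finset.sum_apply, Finset.sum_mul]
    rw [Finset.sum_comm, Nat.cast_sum, Finset.mul_sum]
    refine Finset.sum_congr rfl fun φ hφ => ?_
    simp only [Pi.smul_apply, smul_mul_assoc]
    rw [← Finset.smul_sum, hk φ hφ, nsmul_eq_mul]
    push_cast
    ring
  rw [hsum]
  refine mul_ne_zero h0 (Nat.cast_ne_zero.2 fun h => ?_)
  have := (Finset.sum_eq_zero_iff.1 h) _ (Finsupp.mem_support_iff.2 hne)
  exact (mul_ne_zero hne hσk) this

/-- A map twisted by `g` is an intertwiner from `σ` to its conjugate by `g`. The two characters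
agree, so orthogonality provides a nonzero one. -/
theorem exists_isTwisted_of_character_eq [Finite G] {N : Subgroup G} [N.Normal]
    {σ : Representation ℂ N W} (hσ : σ.IsIrreducible) {g : G}
    (hg : ∀ n : N, σ.character (MulAut.conjNormal g n) = σ.character n) :
    ∃ Y, Y ≠ 0 ∧ IsTwisted σ g Y := by
  have : Fintype N := Fintype.ofFinite N
  let σ' : Representation ℂ N W := σ.comp (MulAut.conjNormal g).toMonoidHom
  have hchar : σ'.character = σ.character := funext hg
  obtain ⟨f, hf⟩ := exists_ne_zero_of_sum_ne_zero (ρ := σ) (σ := σ') (by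
    rw [hchar, sum_character_mul_inv]
    exact mul_ne_zero (by exact_mod_cast Nat.card_pos.ne')
      (Nat.cast_ne_zero.2 (finrank_intertwiningMap_self_ne_zero hσ)))
  refine ⟨f.toLinearMap, fun h => hf ?_, fun n => f.isIntertwining' n⟩
  ext v
  exact LinearMap.congr_fun h v

end Characters

theorem normalizer_sylow_eq_of_normalizer_eq {p : ℕ} [Fact p.Prime] {G : Type*} [Group G]
    [Finite G] {P : Sylow p G} (hP : Subgroup.normalizer (P : Set G) = (P : Subgroup G))
    (Q : Sylow p G) : Subgroup.normalizer (Q : Set G) = (Q : Subgroup G) := by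
  refine le_antisymm (fun x hx => ?_) Subgroup.le_normalizer
  obtain ⟨g, rfl⟩ := MulAction.exists_smul_eq G P Q
  have h := Sylow.smul_eq_iff_mem_normalizer.2 hx
  have h' : (g⁻¹ * x * g) • P = P := by
    rw [mul_smul, mul_smul, h, inv_smul_smul]
  have h'' := Sylow.smul_eq_iff_mem_normalizer.1 h'
  rw [hP] at h''
  refine ⟨_, h'', ?_⟩
  simp [mul_assoc]

end CharExt

theorem theorem3p3 {G : Type*} [Group G] [Finite G] (p : ℕ) [Fact p.Prime]
    (hG : CharExt.IsPSolvable p G)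
    (P : Sylow p G) (hP : Subgroup.normalizer (P : Set G) = (P : Subgroup G))
    (N : Subgroup G) [N.Normal]
    (χ : G → ℂ) (hχ : CharExt.IsIrrChar χ) (hχp : CharExt.HasPrimeToDegree p χ)
    (θ : N → ℂ) (hθ : CharExt.IsIrrChar θ) (hθχ : CharExt.LiesUnder θ χ) :
    CharExt.ExtendsTo θ (CharExt.stabilizer θ) := by
  obtain ⟨a, ρ, hρ, rfl⟩ := hχ
  obtain ⟨b, σ, hσ, rfl⟩ := hθ
  obtain ⟨d, hd, hdp⟩ := hχp
  have : Fintype N := Fintype.ofFinite N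
  have hNH : N ≤ CharExt.stabilizer σ.character := fun n hn m => by
    have : MulAut.conjNormal n m = ⟨n, hn⟩ * m * ⟨n, hn⟩⁻¹ := by
      ext
      simp
    rw [this, Representation.char_conj]
  have hdim : ¬ p ∣ Module.finrank ℂ (Fin a → ℂ) := by
    rw [Representation.char_one] at hd
    rw [Nat.cast_injective hd]
    exact (Fact.out : p.Prime).coprime_iff_not_dvd.1 hdp.symm
  obtain ⟨f, hf⟩ := CharExt.exists_ne_zero_of_sum_ne_zero (ρ := σ) (σ := ρ.comp N.subtype)
    (CharExt.sum_ne_zero_of_isConstituent hσ hθχ)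
  obtain ⟨τ, hτ⟩ := CharExt.extensionProperty hG.hasExponentSeries
    (CharExt.normalizer_sylow_eq_of_normalizer_eq hP) _ _ N (CharExt.stabilizer σ.character) hNH
    ρ σ f.toLinearMap hρ hσ hdim
    ((Representation.IsIrreducible.injective_or_eq_zero f).resolve_right hf)
    (fun n u => LinearMap.congr_fun (f.isIntertwining' n) u)
    (fun h hh => CharExt.exists_isTwisted_of_character_eq hσ hh)
  refine ⟨hNH, τ.character, ⟨b, τ, ?_, rfl⟩, fun n => ?_⟩
  · rw [CharExt.isIrreducible_iff] at hσ ⊢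
    exact ⟨hσ.1, fun W hW => hσ.2 W fun n w hw => hτ n ▸ hW _ w hw⟩
  · rw [Representation.character, hτ]
    rfl
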